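/- **Setting.** There are $n\ge 1$ agents and $m\ge 1$ objects. A valuation profile $v=(v_{ij})$ consists of values $v_{ij}\ge 0$ with $\sum_j v_{ij}>0$ for every agent $i$. A (random) allocation is a matrix $p=(p_{ij})$ with $p_{ij}\in[0,1]$ and $\sum_i p_{ij}\le 1$ for every object $j$; write $p_i$ for its $i$-th row. For a bundle $x\in\mathbb R_{\ge0}^m$ put $u_i(x)=\sum_j x_jv_{ij}$ and $u_i(O)=\sum_j v_{ij}$. The egalitarian value of $p$ is $EV(p,v)=\min_i u_i(p_i)/u_i(O)$, and $OEV(v)=\sup_p EV(p,v)$ over all allocations $p$. A mechanism $J$ for $n$ agents and $m$ objects maps each profile $v$ to an allocation $J(v)$, and $$guar(J)=\inf_v \frac{EV(J(v),v)}{OEV(v)},$$ where $v$ ranges over all valuation profiles of $n$ agents over $m$ objects. For prices $q\in\mathbb R_{\ge 0}^m$, say that $q$ clears the market at $p$ if $\sum_i p_{ij}=1$ for every $j$ with $q_j>0$. * $J$ is a *CEEI mechanism* (competitive equilibrium with equal incomes) if for every $v$ there are prices $q\in\mathbb R_{\ge0}^m$ clearing the market at $p=J(v)$ such that each row $p_i$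 maximizes $u_i$ over $\{y\in\mathbb R_{\ge0}^m: q\cdot y\le 1\}$ and itself belongs to this set. * $J$ is a *pseudo-market (PM) mechanism* (Hylland–Zeckhauser) if for every $v$ there are prices $q\in\mathbb R_{\ge0}^m$ clearing the market at $p=J(v)$ such that each row $p_i$ belongs to $\{y\in\mathbb R_{\ge0}^m: \sum_j y_j\le 1,\ q\cdot y\le 1\}$, maximizes $u_i$ over this set, and has the least cost $q\cdot p_i$ among all maximizers. **Corollary** ($guar(CEEI)=O(n^{-1/5})$ and $guar(PM)=O(n^{-1/5})$). There is an absolute constant $C>0$ such that for all $n\ge1$ and all $m\ge n$, every CEEI mechanism and every PM mechanism $J$ for $n$ agents and $m$ objects satisfies $$guar(J)\le C\,n^{-1/5}.$$ In particular, the bound holds for the worst case over all numbers $m$ of objects. -/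

import Mathlib

namespace RandomAssignment

/-- A valuation profile of `n` agents over `m` objects: `val i j` is the (nonnegative) value of
agent `i` for object `j`; every agent has positive total value, so that the ratios
`u_i(p(i)) / u_i(O)` make sense. Values are not normalised. -/
structure Profile (n m : ℕ) where
  val : Fin n → Fin m → ℝ
  nonneg : ∀ i j, 0 ≤ val i j
  total_pos : ∀ i, 0 < ∑ j, val i j

/-- A feasible random (fractional) allocation: `prob i j ∈ [0,1]` is the probability that agent `i`
receives object `j`. Each object is handed out with total probability at most one (it may be left
unallocated with some probability); an agent may receive several objects. -/
structure Allocation (n m : ℕ) where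
  prob : Fin n → Fin m → ℝ
  mem_unit : ∀ i j, prob i j ∈ Set.Icc (0 : ℝ) 1
  supply : ∀ j, ∑ i, prob i j ≤ 1

/-- A randomized mechanism for `n` agents and `m` objects. -/
abbrev Mechanism (n m : ℕ) : Type := Profile n m → Allocation n m

variable {n m : ℕ}

/-- The (additive, expected) utility `u_i(x)` of agent `i` from the bundle `x`. -/
def Profile.utility (v : Profile n m) (i : Fin n) (x : Fin m → ℝ) : ℝ :=
  ∑ j, x j * v.val i j

/-- The total value `u_i(O)` of agent `i` for all objects. -/
def Profile.total (v : Profile n m) (i : Fin n) : ℝ :=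
  ∑ j, v.val i j

/-- The egalitarian value `EV(p, v)`. -/
noncomputable def egalitarianValue (p : Allocation n m) (v : Profile n m) : ℝ :=
  ⨅ i, v.utility i (p.prob i) / v.total i

/-- The optimal egalitarian value `OEV(v)`. -/
noncomputable def optimalEgalitarianValue (v : Profile n m) : ℝ :=
  sSup {r : ℝ | ∃ p : Allocation n m, egalitarianValue p v = r}

/-- The approximation ratio `aar(J, v) = EV(J(v), v) / OEV(v)` of `J` at `v`. -/
noncomputable def approxRatio (J : Mechanism n m) (v : Profile n m) : ℝ :=
  egalitarianValue (J v) v / optimalEgalitarianValue v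

/-- The guaranteed approximation ratio `guar(J) = inf_v aar(J, v)`. -/
noncomputable def guar (J : Mechanism n m) : ℝ :=
  ⨅ v, approxRatio J v

/-- The cost of the bundle `x` at the prices `q`. -/
def cost (q x : Fin m → ℝ) : ℝ := ∑ j, q j * x j

/-- Market clearing: every object with a positive price is completely sold (no object is oversold,
by feasibility). -/
def Clears (q : Fin m → ℝ) (p : Allocation n m) : Prop :=
  ∀ j, 0 < q j → ∑ i, p.prob i j = 1

/-- `p` is an allocation of a competitive equilibrium with equal incomes: for some nonnegative
prices that clear the market, each agent, having income one, gets a bundle that is utility-maximal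
among all bundles of divisible objects that cost at most one. -/
def IsCEEIAllocation (v : Profile n m) (p : Allocation n m) : Prop :=
  ∃ q : Fin m → ℝ, (∀ j, 0 ≤ q j) ∧ Clears q p ∧
    ∀ i, cost q (p.prob i) ≤ 1 ∧
      ∀ y : Fin m → ℝ, (∀ j, 0 ≤ y j) → cost q y ≤ 1 →
        v.utility i y ≤ v.utility i (p.prob i)

/-- `p` is an allocation of a Hylland–Zeckhauser pseudo-market equilibrium: agents have unit demand
and choose among lotteries over the objects (with total probability at most one, the rest being the
null object). For some nonnegative prices that clear the market, each agent, having a budget of one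
unit of token money, gets a utility-maximal affordable lottery, and a cheapest one among these. -/
def IsPseudoMarketAllocation (v : Profile n m) (p : Allocation n m) : Prop :=
  ∃ q : Fin m → ℝ, (∀ j, 0 ≤ q j) ∧ Clears q p ∧
    ∀ i, ∑ j, p.prob i j ≤ 1 ∧ cost q (p.prob i) ≤ 1 ∧
      ∀ y : Fin m → ℝ, (∀ j, 0 ≤ y j) → ∑ j, y j ≤ 1 → cost q y ≤ 1 →
        v.utility i y ≤ v.utility i (p.prob i) ∧
        (v.utility i y = v.utility i (p.prob i) → cost q (p.prob i) ≤ cost q y)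

/-- `J` is a CEEI mechanism: at every profile it returns an equilibrium allocation (the choice
among several equilibria is arbitrary). -/
def IsCEEI (J : Mechanism n m) : Prop := ∀ v, IsCEEIAllocation v (J v)

/-- `J` is a pseudo-market mechanism: at every profile it returns an equilibrium allocation (the
choice among several equilibria is arbitrary). -/
def IsPseudoMarket (J : Mechanism n m) : Prop := ∀ v, IsPseudoMarketAllocation v (J v)

end RandomAssignment

/-!
The bound is witnessed by one profile, on which the ratio is even at most `4 / n`. A *hub* agent `0`
values the first `n` objects equally, and every other agent `i` values only the object `i`. Giving
the hub one half of each of the first `n` objects, and every other agent one half of its own object,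
gives every agent at least half of its total value (`half_le_optimalEgalitarianValue_hubProfile`).

In an equilibrium the hub gets at most two of the `n` objects it values, hence at most `2 / n` of
its total value. For a pseudo-market this is the unit-demand constraint. For CEEI, each of the
objects `1, …, n - 1` has a price of at least one, since otherwise the agent of that number would
demand more than the one unit that exists (`one_le_price_of_utility_maximal`). So the income of the
hub pays for at most one unit of these objects, and the object `0` adds at most one more.
-/

namespace RandomAssignment

variable {n m : ℕ}

/-! ### Egalitarian values of arbitrary profiles -/

theorem Profile.total_eq_utility_one (v : Profile n m) (i : Fin n) :
    v.total i = v.utility i fun _ => 1 := by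
  simp [Profile.total, Profile.utility]

theorem Profile.utility_nonneg (v : Profile n m) (i : Fin n) {x : Fin m → ℝ} (hx : ∀ j, 0 ≤ x j) :
    0 ≤ v.utility i x :=
  Finset.sum_nonneg fun j _ => mul_nonneg (hx j) (v.nonneg i j)

theorem Profile.utility_le_total (v : Profile n m) (i : Fin n) {x : Fin m → ℝ}
    (hx : ∀ j, x j ≤ 1) : v.utility i x ≤ v.total i :=
  Finset.sum_le_sum fun j _ => mul_le_of_le_one_left (v.nonneg i j) (hx j)

theorem egalitarianValue_nonneg (p : Allocation n m) (v : Profile n m) :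
    0 ≤ egalitarianValue p v :=
  Real.iInf_nonneg fun i =>
    div_nonneg (v.utility_nonneg i fun j => (p.mem_unit i j).1) (v.total_pos i).le

theorem egalitarianValue_le (p : Allocation n m) (v : Profile n m) (i : Fin n) :
    egalitarianValue p v ≤ v.utility i (p.prob i) / v.total i :=
  ciInf_le (Set.finite_range _).bddBelow i

theorem egalitarianValue_le_optimalEgalitarianValue [NeZero n] (p : Allocation n m)
    (v : Profile n m) : egalitarianValue p v ≤ optimalEgalitarianValue v := by
  refine le_csSup ⟨1, ?_⟩ ⟨p, rfl⟩
  rintro r ⟨p', rfl⟩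
  exact (egalitarianValue_le p' v 0).trans
    (div_le_one_of_le₀ (v.utility_le_total 0 fun j => (p'.mem_unit 0 j).2) (v.total_pos 0).le)

theorem optimalEgalitarianValue_nonneg (v : Profile n m) : 0 ≤ optimalEgalitarianValue v :=
  Real.sSup_nonneg (by rintro r ⟨p, rfl⟩; exact egalitarianValue_nonneg p v)

theorem guar_le_approxRatio (J : Mechanism n m) (v : Profile n m) : guar J ≤ approxRatio J v := by
  refine ciInf_le ⟨0, ?_⟩ v
  rintro r ⟨w, rfl⟩
  exact div_nonneg (egalitarianValue_nonneg _ w) (optimalEgalitarianValue_nonneg w)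

/-! ### Sums over the first objects -/

theorem sum_mul_indicator_castLE (h : n ≤ m) (x : Fin m → ℝ) :
    ∑ j, x j * (if ∃ k, j = Fin.castLE h k then 1 else 0) = ∑ k, x (Fin.castLE h k) := by
  classical
  simp only [mul_ite, mul_one, mul_zero, ← Finset.sum_filter]
  rw [← Finset.sum_image (g := Fin.castLE h) (f := x) (s := Finset.univ)
    fun a _ b _ hab => Fin.castLE_injective h hab]
  congr 1
  ext j
  simp [eq_comm]

theorem sum_castLE_le_sum (h : n ≤ m) {x : Fin m → ℝ} (hx : ∀ j, 0 ≤ x j) :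
    ∑ k : Fin n, x (Fin.castLE h k) ≤ ∑ j, x j := by
  rw [← sum_mul_indicator_castLE h x]
  refine Finset.sum_le_sum fun j _ => mul_le_of_le_one_right (hx j) ?_
  split_ifs <;> norm_num

/-! ### The hub profile -/

section Hub

variable [NeZero n] (h : n ≤ m)

/-- The profile in which the hub agent `0` values the first `n` objects at `1` each and every other
agent `i` values only the object `i`, at `1`. -/
def hubProfile : Profile n m where
  val i j := if i = 0 then (if ∃ k, j = Fin.castLE h k then 1 else 0)
    else if j = Fin.castLE h i then 1 else 0
  nonneg i j := by split_ifs <;> norm_num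
  total_pos i := by
    by_cases hi : i = 0
    · have hsum := sum_mul_indicator_castLE h fun _ => 1
      simp only [one_mul] at hsum
      simp only [if_pos hi, hsum]
      simpa using Nat.pos_of_neZero n
    · simp [hi]

theorem hubProfile_utility_zero (x : Fin m → ℝ) :
    (hubProfile h).utility 0 x = ∑ k, x (Fin.castLE h k) := by
  simpa [Profile.utility, hubProfile] using sum_mul_indicator_castLE h x

theorem hubProfile_utility_of_ne {i : Fin n} (hi : i ≠ 0) (x : Fin m → ℝ) :
    (hubProfile h).utility i x = x (Fin.castLE h i) := by
  simp [Profile.utility, hubProfile, hi]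

/-- The hub gets half of every object, every other agent `i` half of the object `i`. -/
noncomputable def hubAllocation : Allocation n m where
  prob i j := if i = 0 ∨ j = Fin.castLE h i then 1 / 2 else 0
  mem_unit i j := by split_ifs <;> norm_num
  supply j := by
    -- The column sum is at most `1/2` from the hub plus `1/2` from the agent owning `j`, if any.
    have hle : ∀ i : Fin n, (if i = 0 ∨ j = Fin.castLE h i then 1 / 2 else 0 : ℝ) ≤
        (if i = 0 then 1 / 2 else 0) + if j = Fin.castLE h i then 1 / 2 else 0 := by
      intro i
      split_ifs <;> simp_all
    refine (Finset.sum_le_sum fun i _ => hle i).trans ?_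
    rw [Finset.sum_add_distrib, Finset.sum_ite_eq' Finset.univ (0 : Fin n), if_pos (by simp)]
    have hown : ∑ i : Fin n, (if j = Fin.castLE h i then 1 / 2 else 0 : ℝ) ≤ 1 / 2 := by
      by_cases hj : ∃ k, j = Fin.castLE h k
      · obtain ⟨k, rfl⟩ := hj
        simp [Fin.castLE_inj]
      · rw [not_exists] at hj
        simp [hj]
    linarith

theorem half_le_optimalEgalitarianValue_hubProfile :
    1 / 2 ≤ optimalEgalitarianValue (hubProfile (n := n) h) := by
  refine le_trans (le_ciInf fun i => ?_)
    (egalitarianValue_le_optimalEgalitarianValue (hubAllocation h) _)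
  have hpos : 0 < (hubProfile h).total i := (hubProfile h).total_pos i
  rw [le_div_iff₀ hpos, Profile.total_eq_utility_one]
  by_cases hi : i = 0
  · subst hi
    simp [hubProfile_utility_zero, hubAllocation, mul_comm]
  · simp [hubProfile_utility_of_ne h hi, hubAllocation]

/-- Receiving at most two of its `n` objects, the hub gets at most `2 / n` of its total value, while
`1 / 2` is achievable for everyone. -/
theorem guar_le_of_sum_le_two (J : Mechanism n m)
    (hJ : ∑ k, (J (hubProfile h)).prob 0 (Fin.castLE h k) ≤ 2) : guar J ≤ 4 / n := by
  have hn : (0 : ℝ) < n := by exact_mod_cast Nat.pos_of_neZero n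
  have hopt := half_le_optimalEgalitarianValue_hubProfile (n := n) h
  have hEV : egalitarianValue (J (hubProfile h)) (hubProfile h) ≤ 2 / n := by
    refine (egalitarianValue_le _ _ 0).trans ?_
    rw [Profile.total_eq_utility_one, hubProfile_utility_zero, hubProfile_utility_zero]
    simp only [Finset.sum_const, Finset.card_univ, Fintype.card_fin, nsmul_eq_mul, mul_one]
    gcongr
  refine (guar_le_approxRatio J (hubProfile h)).trans ?_
  calc approxRatio J (hubProfile h) ≤ (2 / n) / (1 / 2) :=
        div_le_div₀ (by positivity) hEV (by norm_num) hopt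
    _ = 4 / n := by ring

/-! ### Equilibria of the hub profile -/

/-- At a price below `1`, agent `i` could afford more than the one unit of the object `i` that
exists. -/
theorem one_le_price_of_utility_maximal {p : Allocation n m} {q : Fin m → ℝ} {i : Fin n}
    (hi : i ≠ 0) (hq : 0 ≤ q (Fin.castLE h i))
    (hmax : ∀ y : Fin m → ℝ, (∀ j, 0 ≤ y j) → cost q y ≤ 1 →
      (hubProfile h).utility i y ≤ (hubProfile h).utility i (p.prob i)) :
    1 ≤ q (Fin.castLE h i) := by
  by_contra! hlt
  -- This amount exceeds `1` and costs at most `1`, also when the price is zero.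
  set c : ℝ := 2 / (1 + q (Fin.castLE h i)) with hc
  have hc1 : 1 < c := by
    rw [hc, lt_div_iff₀ (by linarith)]
    linarith
  have hle := hmax (Pi.single (Fin.castLE h i) c)
    (fun j => by
      have hpos : 0 ≤ c := zero_le_one.trans hc1.le
      rw [Pi.single_apply]
      split_ifs <;> simp [hpos]) (by
      have hcost : cost q (Pi.single (Fin.castLE h i) c) = q (Fin.castLE h i) * c := by
        simp [cost, Pi.single_apply]
      rw [hcost, hc, mul_div_assoc', div_le_one (by linarith)]
      linarith)
  rw [hubProfile_utility_of_ne h hi, hubProfile_utility_of_ne h hi, Pi.single_eq_same] at hle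
  linarith [(p.mem_unit i (Fin.castLE h i)).2]

theorem IsCEEIAllocation.sum_hub_le_two {p : Allocation n m}
    (hp : IsCEEIAllocation (hubProfile h) p) : ∑ k, p.prob 0 (Fin.castLE h k) ≤ 2 := by
  obtain ⟨q, hq, -, heq⟩ := hp
  have hterm : ∀ k : Fin n, p.prob 0 (Fin.castLE h k) ≤
      (if k = 0 then 1 else 0) + q (Fin.castLE h k) * p.prob 0 (Fin.castLE h k) := by
    intro k
    have hp0 := p.mem_unit 0 (Fin.castLE h k)
    split_ifs with hk
    · exact hp0.2.trans (le_add_of_nonneg_right (mul_nonneg (hq _) hp0.1))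
    · rw [zero_add]
      exact le_mul_of_one_le_left hp0.1 (one_le_price_of_utility_maximal h hk (hq _) (heq k).2)
  have hcost := (sum_castLE_le_sum h fun j => mul_nonneg (hq j) (p.mem_unit 0 j).1).trans (heq 0).1
  refine (Finset.sum_le_sum fun k _ => hterm k).trans ?_
  rw [Finset.sum_add_distrib, Finset.sum_ite_eq' Finset.univ (0 : Fin n), if_pos (by simp)]
  linarith

theorem IsPseudoMarketAllocation.sum_hub_le_one {v : Profile n m} {p : Allocation n m}
    (hp : IsPseudoMarketAllocation v p) : ∑ k, p.prob 0 (Fin.castLE h k) ≤ 1 := by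
  obtain ⟨q, -, -, heq⟩ := hp
  exact (sum_castLE_le_sum h fun j => (p.mem_unit 0 j).1).trans (heq 0).1

end Hub

end RandomAssignment

open RandomAssignment in
theorem mainTheorem9 :
    ∃ C : ℝ, 0 < C ∧ ∀ n m : ℕ, 1 ≤ n → n ≤ m →
      (∀ J : RandomAssignment.Mechanism n m, RandomAssignment.IsCEEI J →
        RandomAssignment.guar J ≤ C * (n : ℝ) ^ (-(1 / 5) : ℝ)) ∧
      (∀ J : RandomAssignment.Mechanism n m, RandomAssignment.IsPseudoMarket J →
        RandomAssignment.guar J ≤ C * (n : ℝ) ^ (-(1 / 5) : ℝ)) := by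
  refine ⟨4, by norm_num, fun n m hn h => ?_⟩
  have : NeZero n := ⟨by omega⟩
  have hrate : (4 : ℝ) / n ≤ 4 * (n : ℝ) ^ (-(1 / 5) : ℝ) := by
    rw [div_eq_mul_inv, ← Real.rpow_neg_one]
    gcongr
    · exact_mod_cast hn
    · norm_num
  refine ⟨fun J hJ => (guar_le_of_sum_le_two h J ?_).trans hrate,
    fun J hJ => (guar_le_of_sum_le_two h J ?_).trans hrate⟩
  · exact (hJ _).sum_hub_le_two h
  · linarith [(hJ (hubProfile h)).sum_hub_le_one h]
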